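/- Let $n\ge 1$, let $\lambda=\operatorname{diag}(\lambda_1,\dots,\lambda_n)$ be a real diagonal matrix with $\lambda_1>\dots>\lambda_n$ and $\sum_i\lambda_i=0$. Identify $\mathfrak{su}(n)^*$ with the space of traceless Hermitian $n\times n$ matrices, on which $SU(n)$ acts by conjugation, and let $M=\{g\lambda g^{-1} : g\in SU(n)\}$ be the (regular) coadjoint orbit through $\lambda$, with its Kostant–Kirillov symplectic form $\omega_A([X,A],[Y,A])=\langle A,[X,Y]\rangle$ for $A\in M$, $X,Y\in\mathfrak{su}(n)$. Let $$\mu:M\to\{x\in\mathbb{R}^n : \textstyle\sum_i x_i=0\},\qquad \mu(A)=(a_{11},\dots,a_{nn}),$$ be the momentum map of the action of the diagonal maximal torus of $SU(n)$, and let $\mathcal{Q}=\mu(M)$ be its moment polytope. Let $x$ be a point of the interior of $\mathcal{Q}$ (relative to the hyperplane $\sum_i x_i=0$) with $x\neq(0,\dots,0)$. Then the fiber $\mu^{-1}(x)$ is displaceable: there is a Hamiltonian diffeomorphism $\psi$ of $(M,\omega)$ (the time-one map of the isotopy generated by a smooth time-dependent Hamiltonian on $M$) such that $\psi(\mu^{-1}(x))\cap\mu^{-1}(x)=\emptyset$.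 Moreover, for every even permutation $\sigma$ of $\{1,\dots,n\}$ the permutation matrix $P_\sigma$ lies in $SU(n)$ and the conjugation $A\mapsto P_\sigma A P_\sigma^{-1}$ is a Hamiltonian diffeomorphism of $M$; and if $n\ge 3$, then $\sigma$ can be chosen even such that this conjugation displaces $\mu^{-1}(x)$, i.e. $P_\sigma\,\mu^{-1}(x)\,P_\sigma^{-1}\cap\mu^{-1}(x)=\emptyset$. -/

import Mathlib

open scoped Matrix ContDiff

namespace SUOrbit

/-- Complex `n × n` matrices. -/
abbrev Mat (n : ℕ) : Type := Matrix (Fin n) (Fin n) ℂ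

/-- The special unitary group `SU(n)`. -/
abbrev SU (n : ℕ) := Matrix.specialUnitaryGroup (Fin n) ℂ

/-- The Lie algebra `su(n)`: skew-Hermitian matrices of trace zero, a real vector space. -/
def su (n : ℕ) : Submodule ℝ (Mat n) where
  carrier := {X | Xᴴ = -X ∧ X.trace = 0}
  zero_mem' := by simp
  add_mem' := by
    rintro X Y ⟨hX, hX0⟩ ⟨hY, hY0⟩
    refine ⟨?_, ?_⟩
    · rw [Matrix.conjTranspose_add, hX, hY, neg_add]
    · rw [Matrix.trace_add, hX0, hY0, add_zero]
  smul_mem' := by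
    rintro c X ⟨hX, hX0⟩
    refine ⟨?_, ?_⟩
    · rw [Matrix.conjTranspose_smul, hX, star_trivial, smul_neg]
    · rw [Matrix.trace_smul, hX0, smul_zero]

/-- The dual `{x ∈ ℝⁿ | ∑ xᵢ = 0}` of the Lie algebra of the diagonal maximal torus of `SU(n)`,
with the topology of a subspace of `ℝⁿ`. -/
def torusDual (n : ℕ) : Submodule ℝ (Fin n → ℝ) where
  carrier := {x | ∑ i, x i = 0}
  zero_mem' := by simp
  add_mem' := by
    intro x y hx hy
    simp only [Set.mem_ofPred_eq] at hx hy ⊢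
    simp [Finset.sum_add_distrib, hx, hy]
  smul_mem' := by
    intro c x hx
    simp only [Set.mem_ofPred_eq] at hx ⊢
    simp [← Finset.mul_sum, hx]

/-- The diagonal Hermitian matrix with diagonal entries `lam 0, …, lam (n-1)`. -/
noncomputable def diagMat {n : ℕ} (lam : torusDual n) : Mat n :=
  Matrix.diagonal fun i => ((lam : Fin n → ℝ) i : ℂ)

/-- The coadjoint orbit through `diag lam`, where `su(n)*` is identified with the traceless
Hermitian matrices (a Hermitian `A` is the functional `X ↦ Im tr (A X)` on `su(n)`), so that
`SU(n)` acts by conjugation. -/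
def orbit {n : ℕ} (lam : torusDual n) : Set (Mat n) :=
  {A | ∃ g : SU n, A = (g : Mat n) * diagMat lam * (g : Mat n)ᴴ}

theorem SU_conjTranspose_mul {n : ℕ} (g : SU n) : (g : Mat n)ᴴ * (g : Mat n) = 1 :=
  (Matrix.mem_unitaryGroup_iff'.1 (Matrix.mem_specialUnitaryGroup_iff.1 g.2).1)

theorem SU_mul_conjTranspose {n : ℕ} (g : SU n) : (g : Mat n) * (g : Mat n)ᴴ = 1 :=
  (Matrix.mem_unitaryGroup_iff.1 (Matrix.mem_specialUnitaryGroup_iff.1 g.2).1)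

theorem conj_mem_orbit {n : ℕ} (lam : torusDual n) (g : SU n) {A : Mat n} (hA : A ∈ orbit lam) :
    (g : Mat n) * A * (g : Mat n)ᴴ ∈ orbit lam := by
  obtain ⟨k, rfl⟩ := hA
  refine ⟨g * k, ?_⟩
  simp [Matrix.conjTranspose_mul, Matrix.mul_assoc]

theorem coe_inv_SU {n : ℕ} (g : SU n) : ((g⁻¹ : SU n) : Mat n) = (g : Mat n)ᴴ := rfl

/-- The coadjoint action of `g ∈ SU(n)` on the orbit: conjugation `A ↦ g A g⁻¹ = g A g*`. -/
def coadjoint {n : ℕ} (lam : torusDual n) (g : SU n) : orbit lam ≃ orbit lam where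
  toFun A := ⟨(g : Mat n) * (A : Mat n) * (g : Mat n)ᴴ, conj_mem_orbit lam g A.2⟩
  invFun A := ⟨((g⁻¹ : SU n) : Mat n) * (A : Mat n) * ((g⁻¹ : SU n) : Mat n)ᴴ,
    conj_mem_orbit lam g⁻¹ A.2⟩
  left_inv A := by
    apply Subtype.ext
    simp only [coe_inv_SU, Matrix.conjTranspose_conjTranspose]
    calc (g : Mat n)ᴴ * ((g : Mat n) * (A : Mat n) * (g : Mat n)ᴴ) * (g : Mat n)
        = ((g : Mat n)ᴴ * (g : Mat n)) * (A : Mat n) * ((g : Mat n)ᴴ * (g : Mat n)) := by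
          simp only [Matrix.mul_assoc]
      _ = A := by rw [SU_conjTranspose_mul]; simp
  right_inv A := by
    apply Subtype.ext
    simp only [coe_inv_SU, Matrix.conjTranspose_conjTranspose]
    calc (g : Mat n) * ((g : Mat n)ᴴ * (A : Mat n) * (g : Mat n)) * (g : Mat n)ᴴ
        = ((g : Mat n) * (g : Mat n)ᴴ) * (A : Mat n) * ((g : Mat n) * (g : Mat n)ᴴ) := by
          simp only [Matrix.mul_assoc]
      _ = A := by rw [SU_mul_conjTranspose]; simp

/-- The linear map `X ↦ [X, A] = X A - A X`; on `su(n)` it sends `X` to the value at `A` of the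
vector field generated by `X` through the coadjoint action. -/
noncomputable def infinitesimalAction {n : ℕ} (A : Mat n) : Mat n →ₗ[ℝ] Mat n where
  toFun X := X * A - A * X
  map_add' X Y := by rw [add_mul, mul_add]; abel
  map_smul' c X := by simp [smul_sub]

/-- The tangent space at `A` of the coadjoint orbit through `A`. -/
noncomputable def tangentSpace {n : ℕ} (A : Mat n) : Submodule ℝ (Mat n) :=
  (su n).map (infinitesimalAction A)

/-- A chosen `X ∈ su(n)` with `[X, A] = v`. -/
noncomputable def generator {n : ℕ} {A : Mat n} (v : tangentSpace A) : Mat n :=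
  Classical.choose v.2

theorem generator_mem {n : ℕ} {A : Mat n} (v : tangentSpace A) : generator v ∈ su n :=
  (Classical.choose_spec v.2).1

theorem action_generator {n : ℕ} {A : Mat n} (v : tangentSpace A) :
    infinitesimalAction A (generator v) = v :=
  (Classical.choose_spec v.2).2

/-- The Kostant–Kirillov form `ω_A([X, A], [Y, A]) = ⟨A, [X, Y]⟩ = Im tr (A [X, Y])`
for `X, Y ∈ su(n)`; see `kksForm_apply` for the independence of the choice of `X` and `Y`. -/
noncomputable def kksForm {n : ℕ} {A : Mat n} (v w : tangentSpace A) : ℝ :=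
  (A * (generator v * generator w - generator w * generator v)).trace.im

theorem trace_mul_comm_eq_left {n : ℕ} (A X Y : Mat n) :
    (A * (X * Y - Y * X)).trace = -(infinitesimalAction A X * Y).trace := by
  have h : (A * (Y * X)).trace = (X * A * Y).trace := by
    rw [← Matrix.mul_assoc, Matrix.trace_mul_comm, ← Matrix.mul_assoc]
  simp only [infinitesimalAction, LinearMap.coe_mk, AddHom.coe_mk, Matrix.mul_sub, Matrix.sub_mul,
    Matrix.trace_sub, h, Matrix.mul_assoc]
  ring

theorem trace_mul_comm_eq_right {n : ℕ} (A X Y : Mat n) :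
    (A * (X * Y - Y * X)).trace = (infinitesimalAction A Y * X).trace := by
  have h := trace_mul_comm_eq_left A Y X
  rw [← neg_sub (X * Y), Matrix.mul_neg, Matrix.trace_neg, neg_inj] at h
  exact h

theorem kksForm_apply {n : ℕ} {A : Mat n} (v w : tangentSpace A) {X Y : Mat n}
    (hX : infinitesimalAction A X = v) (hY : infinitesimalAction A Y = w) :
    kksForm v w = (A * (X * Y - Y * X)).trace.im := by
  have h1 : (A * (generator v * generator w - generator w * generator v)).trace
      = (A * (X * generator w - generator w * X)).trace := by
    rw [trace_mul_comm_eq_left, trace_mul_comm_eq_left, action_generator, hX]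
  have h2 : (A * (X * generator w - generator w * X)).trace = (A * (X * Y - Y * X)).trace := by
    rw [trace_mul_comm_eq_right, trace_mul_comm_eq_right, action_generator, hY]
  rw [kksForm, h1, h2]

section Isotopy

/- Any norm gives the same notion of smoothness; this one is the maximum of the entries. -/
attribute [local instance] Matrix.normedAddCommGroup Matrix.normedSpace

/-- Smoothness of a map `[0,1] × M → M`, where `M` is the orbit, a compact embedded submanifold
of the matrix space: such a map is smooth exactly if it is the restriction of a smooth map of the
ambient space `ℝ × Mat n`. Values of `f` at times outside `[0,1]` play no role. -/
def IsSmoothFamily {n : ℕ} (lam : torusDual n) (f : ℝ → orbit lam → orbit lam) : Prop :=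
  ∃ F : ℝ × Mat n → Mat n, ContDiff ℝ ∞ F ∧
    ∀ t ∈ Set.Icc (0 : ℝ) 1, ∀ A : orbit lam, F (t, (A : Mat n)) = f t A

/-- `φ` (restricted to times in `[0,1]`) is a Hamiltonian isotopy of the orbit with its
Kostant–Kirillov form: a smooth isotopy starting at the identity which satisfies
`d/dt φ_t = X_{H_t} ∘ φ_t`, where `ω(X_{H_t}, ·) = dH_t`, for a smooth time-dependent
Hamiltonian `H`. A smooth function on `[0,1] × M` is given by a smooth extension to
`ℝ × Mat n`, of which only the restriction to `[0,1] × M` matters. -/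
structure IsHamiltonianIsotopy {n : ℕ} (lam : torusDual n)
    (φ : ℝ → (orbit lam ≃ orbit lam)) : Prop where
  smooth : IsSmoothFamily lam fun t => φ t
  smooth_symm : IsSmoothFamily lam fun t => (φ t).symm
  map_zero : φ 0 = Equiv.refl _
  hamiltonian : ∃ H : ℝ × Mat n → ℝ, ContDiff ℝ ∞ H ∧
    ∀ t ∈ Set.Icc (0 : ℝ) 1, ∀ A : orbit lam,
      ∃ v : tangentSpace (φ t A : Mat n),
        HasDerivWithinAt (fun s => (φ s A : Mat n)) (v : Mat n) (Set.Icc 0 1) t ∧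
        ∀ w : tangentSpace (φ t A : Mat n),
          kksForm v w = fderiv ℝ (fun B : Mat n => H (t, B)) (φ t A : Mat n) (w : Mat n)

end Isotopy

/-- `ψ` belongs to `Ham(M, ω)`: it is the time-one map of a Hamiltonian isotopy. -/
def IsHamiltonianDiffeo {n : ℕ} (lam : torusDual n) (ψ : orbit lam ≃ orbit lam) : Prop :=
  ∃ φ : ℝ → (orbit lam ≃ orbit lam), IsHamiltonianIsotopy lam φ ∧ φ 1 = ψ

/-- `ψ` moves the subset `L` off itself. -/
def Displaces {n : ℕ} {lam : torusDual n} (ψ : orbit lam ≃ orbit lam) (L : Set (orbit lam)) :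
    Prop :=
  (ψ '' L) ∩ L = ∅

/-- A subset of the orbit is displaceable if some Hamiltonian diffeomorphism moves it off
itself. -/
def IsDisplaceable {n : ℕ} (lam : torusDual n) (L : Set (orbit lam)) : Prop :=
  ∃ ψ : orbit lam ≃ orbit lam, IsHamiltonianDiffeo lam ψ ∧ Displaces ψ L

theorem sum_diag_re {n : ℕ} (lam : torusDual n) (A : orbit lam) :
    ∑ i, ((A : Mat n) i i).re = 0 := by
  obtain ⟨A, g, rfl⟩ := A
  have h : ((g : Mat n) * diagMat lam * (g : Mat n)ᴴ).trace = 0 := by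
    rw [Matrix.trace_mul_comm, ← Matrix.mul_assoc, SU_conjTranspose_mul, one_mul, diagMat,
      Matrix.trace_diagonal, ← Complex.ofReal_sum]
    have := lam.2
    change ∑ i, (lam : Fin n → ℝ) i = 0 at this
    rw [this, Complex.ofReal_zero]
  have h' := congrArg Complex.re h
  simpa [Matrix.trace] using h'

/-- The momentum map of the action of the diagonal maximal torus: it sends a (Hermitian) matrix
of the orbit to its diagonal entries, which are real. -/
noncomputable def momentumMap {n : ℕ} (lam : torusDual n) (A : orbit lam) : torusDual n :=
  ⟨fun i => ((A : Mat n) i i).re, sum_diag_re lam A⟩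

/-- The moment polytope: the image of the momentum map. -/
def momentPolytope {n : ℕ} (lam : torusDual n) : Set (torusDual n) :=
  Set.range (momentumMap lam)

/-- The fiber of the momentum map over `x`. -/
def fiber {n : ℕ} (lam : torusDual n) (x : torusDual n) : Set (orbit lam) :=
  {A | momentumMap lam A = x}

/-- The permutation matrix of an even permutation, as an element of `SU(n)`. -/
noncomputable def evenPermMatrix {n : ℕ} (σ : alternatingGroup (Fin n)) : SU n :=
  ⟨Equiv.Perm.permMatrix ℂ (σ : Equiv.Perm (Fin n)), by
    rw [Matrix.mem_specialUnitaryGroup_iff]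
    refine ⟨?_, ?_⟩
    · rw [Matrix.mem_unitaryGroup_iff, Matrix.star_eq_conjTranspose,
        Matrix.conjTranspose_permMatrix, ← Matrix.permMatrix_mul]
      simp
    · rw [Matrix.det_permutation, Equiv.Perm.mem_alternatingGroup.1 σ.2]
      simp⟩

end SUOrbit

open scoped Matrix ContDiff

namespace SUOrbit

/-! ### Unitary conjugation on the orbit -/

section UnitaryConj

/-! Conjugation by a permutation matrix permutes the diagonal entries, so it carries the fiber over
`x` to the fiber over a permutation of `x`. Distinct fibers are disjoint, and a nonzero `x` with
coordinate sum zero has two unequal coordinates; any permutation sending one of their indices to the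
other displaces the fiber (`displaces_permUnitary`).

It remains to see that these conjugations are Hamiltonian. The matrix of a transposition has
determinant `-1`, so the argument runs in `U(n)`, which preserves the same orbit because scalars and
diagonal unitaries can absorb determinants. A transposition matrix is a Hermitian involution, hence
joined to `1` by a smooth unitary path; products of paths give every permutation matrix. Conjugation
along a smooth unitary path `g` is the flow of `B ↦ Im tr (X t * B)` with `X t = g' t * (g t)ᴴ`
(`IsSmoothlyConnectedToOne.isHamiltonianDiffeo`). For `n ≥ 3` the alternating group is transitive,
so an even permutation suffices. -/

theorem conj_mem_orbit_of_unitary {n : ℕ} (lam : torusDual n)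
    (U : Matrix.unitaryGroup (Fin n) ℂ) {A : Mat n} (hA : A ∈ orbit lam) :
    (U : Mat n) * A * (U : Mat n)ᴴ ∈ orbit lam := by
  obtain ⟨k, rfl⟩ := hA
  rcases n with _ | n
  -- Size zero is separate: there is no index `0` to carry the determinant correction below.
  · exact ⟨1, Subsingleton.elim _ _⟩
  have hU : (U : Mat (n + 1)) * (U : Mat (n + 1))ᴴ = 1 := Matrix.mem_unitaryGroup_iff.1 U.2
  have hk : (k : Mat (n + 1)) * (k : Mat (n + 1))ᴴ = 1 := SU_mul_conjTranspose k
  have hdet : star (U : Mat (n + 1)).det * (U : Mat (n + 1)).det = 1 := by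
    have h := congrArg Matrix.det hU
    rw [Matrix.det_mul, Matrix.det_conjTranspose, Matrix.det_one, mul_comm] at h
    exact h
  -- The diagonal unitary `diagonal d` commutes with `diagMat lam` and cancels `det U`, so `U * k *
  -- diagonal d` lies in `SU(n)` and gives the same point of the orbit as `U * k`.
  set d : Fin (n + 1) → ℂ := Function.update 1 0 (star (U : Mat (n + 1)).det) with hd
  have hdd : ∀ i, d i * star (d i) = 1 := by
    intro i
    by_cases hi : i = 0
    · subst hi
      simpa [hd] using hdet
    · simp [hd, hi]
  have hDD : Matrix.diagonal d * (Matrix.diagonal d)ᴴ = 1 := by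
    rw [Matrix.diagonal_conjTranspose, Matrix.diagonal_mul_diagonal, ← Matrix.diagonal_one]
    congr 1
    funext i
    exact hdd i
  have hdetD : (Matrix.diagonal d).det = star (U : Mat (n + 1)).det := by
    rw [Matrix.det_diagonal, Fin.prod_univ_succ]
    simp [hd]
  have hconj : Matrix.diagonal d * diagMat lam * (Matrix.diagonal d)ᴴ = diagMat lam := by
    rw [diagMat, Matrix.diagonal_mul_diagonal]
    simp_rw [mul_comm (d _)]
    rw [← Matrix.diagonal_mul_diagonal, mul_assoc, hDD, mul_one]
  refine ⟨⟨(U : Mat (n + 1)) * (k : Mat (n + 1)) * Matrix.diagonal d, ?_⟩, ?_⟩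
  · rw [Matrix.mem_specialUnitaryGroup_iff, Matrix.mem_unitaryGroup_iff,
      Matrix.star_eq_conjTranspose]
    constructor
    · calc (U : Mat (n + 1)) * (k : Mat (n + 1)) * Matrix.diagonal d * ((U : Mat (n + 1)) * (k : Mat (n + 1)) * Matrix.diagonal d)ᴴ
          = (U : Mat (n + 1)) * ((k : Mat (n + 1)) * (Matrix.diagonal d * (Matrix.diagonal d)ᴴ) * (k : Mat (n + 1))ᴴ)
              * (U : Mat (n + 1))ᴴ := by
            simp only [Matrix.conjTranspose_mul, Matrix.mul_assoc]
        _ = 1 := by rw [hDD, mul_one, hk, mul_one, hU]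
    · rw [Matrix.det_mul, Matrix.det_mul, hdetD, (Matrix.mem_specialUnitaryGroup_iff.1 k.2).2,
        mul_one, mul_comm, hdet]
  · change _ = (U : Mat (n + 1)) * (k : Mat (n + 1)) * Matrix.diagonal d * diagMat lam *
      ((U : Mat (n + 1)) * (k : Mat (n + 1)) * Matrix.diagonal d)ᴴ
    calc (U : Mat (n + 1)) * (k * diagMat lam * (k : Mat (n + 1))ᴴ) * (U : Mat (n + 1))ᴴ
        = (U : Mat (n + 1)) * (k * (Matrix.diagonal d * diagMat lam * (Matrix.diagonal d)ᴴ)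
            * (k : Mat (n + 1))ᴴ) * (U : Mat (n + 1))ᴴ := by rw [hconj]
      _ = _ := by simp only [Matrix.conjTranspose_mul, Matrix.mul_assoc]

theorem unitary_conj_cancel {n : ℕ} {U V : Mat n} (h : U * V = 1) (h' : Uᴴ = V) (A : Mat n) :
    U * (V * A * Vᴴ) * Uᴴ = A := by
  have h'' : Vᴴ = U := by rw [← h', Matrix.conjTranspose_conjTranspose]
  rw [h', h'']
  calc U * (V * A * U) * V = (U * V) * A * (U * V) := by simp only [Matrix.mul_assoc]
    _ = A := by rw [h, one_mul, mul_one]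

/-- Conjugation of the orbit by a unitary matrix. -/
def unitaryConj {n : ℕ} (lam : torusDual n) (U : Matrix.unitaryGroup (Fin n) ℂ) :
    orbit lam ≃ orbit lam where
  toFun A := ⟨(U : Mat n) * (A : Mat n) * (U : Mat n)ᴴ, conj_mem_orbit_of_unitary lam U A.2⟩
  invFun A := ⟨((U⁻¹ : Matrix.unitaryGroup (Fin n) ℂ) : Mat n) * A *
    ((U⁻¹ : Matrix.unitaryGroup (Fin n) ℂ) : Mat n)ᴴ, conj_mem_orbit_of_unitary lam U⁻¹ A.2⟩
  left_inv _ := Subtype.ext <| unitary_conj_cancel (Matrix.mem_unitaryGroup_iff'.1 U.2)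
    (Matrix.conjTranspose_conjTranspose _) _
  right_inv _ := Subtype.ext <| unitary_conj_cancel (Matrix.mem_unitaryGroup_iff.1 U.2) rfl _

theorem unitaryConj_one {n : ℕ} (lam : torusDual n) : unitaryConj lam 1 = Equiv.refl _ := by
  ext1 A
  apply Subtype.ext
  simp [unitaryConj]

end UnitaryConj

/-! ### Smooth unitary paths and their Hamiltonians -/

section Smooth

attribute [local instance] Matrix.normedAddCommGroup Matrix.normedSpace

/-- Matrix multiplication as a continuous real bilinear map. -/
noncomputable def mulCLM (n : ℕ) : Mat n →L[ℝ] Mat n →L[ℝ] Mat n :=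
  (LinearMap.mul ℝ (Mat n)).toContinuousBilinearMap

/-- The conjugate transpose as a continuous real linear map. -/
noncomputable def conjTransposeCLM (n : ℕ) : Mat n →L[ℝ] Mat n :=
  LinearMap.toContinuousLinearMap
    { toFun := fun A => Aᴴ
      map_add' := Matrix.conjTranspose_add
      map_smul' := fun c A => by simp [Matrix.conjTranspose_smul] }

/-- The imaginary part of the trace as a continuous real linear form. -/
noncomputable def imTraceCLM (n : ℕ) : Mat n →L[ℝ] ℝ :=
  LinearMap.toContinuousLinearMap
    { toFun := fun A => A.trace.im
      map_add' := fun A B => by simp [Matrix.trace_add]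
      map_smul' := fun c A => by simp [Matrix.trace_smul] }

theorem ContDiff.mat_mul {E : Type*} [NormedAddCommGroup E] [NormedSpace ℝ E] {n : ℕ}
    {f g : E → Mat n} (hf : ContDiff ℝ ∞ f) (hg : ContDiff ℝ ∞ g) :
    ContDiff ℝ ∞ fun x => f x * g x :=
  (mulCLM n).isBoundedBilinearMap.contDiff.comp (hf.prodMk hg)

theorem ContDiff.mat_conjTranspose {E : Type*} [NormedAddCommGroup E] [NormedSpace ℝ E] {n : ℕ}
    {f : E → Mat n} (hf : ContDiff ℝ ∞ f) : ContDiff ℝ ∞ fun x => (f x)ᴴ :=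
  (conjTransposeCLM n).contDiff.comp hf

theorem HasDerivAt.mat_mul {n : ℕ} {f g : ℝ → Mat n} {f' g' : Mat n} {t : ℝ}
    (hf : HasDerivAt f f' t) (hg : HasDerivAt g g' t) :
    HasDerivAt (fun s => f s * g s) (f t * g' + f' * g t) t :=
  (mulCLM n).hasDerivAt_of_bilinear (fun _ => hf) (fun _ => hg)

theorem HasDerivAt.mat_conjTranspose {n : ℕ} {f : ℝ → Mat n} {f' : Mat n} {t : ℝ}
    (hf : HasDerivAt f f' t) : HasDerivAt (fun s => (f s)ᴴ) f'ᴴ t :=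
  (conjTransposeCLM n).hasFDerivAt.comp_hasDerivAt t hf

/-- Unitary matrices that are joined to the identity by a smooth path of unitary matrices. -/
def IsSmoothlyConnectedToOne {n : ℕ} (U : Matrix.unitaryGroup (Fin n) ℂ) : Prop :=
  ∃ g : ℝ → Matrix.unitaryGroup (Fin n) ℂ,
    ContDiff ℝ ∞ (fun t => (g t : Mat n)) ∧ g 0 = 1 ∧ g 1 = U

theorem IsSmoothlyConnectedToOne.one {n : ℕ} :
    IsSmoothlyConnectedToOne (1 : Matrix.unitaryGroup (Fin n) ℂ) :=
  ⟨fun _ => 1, contDiff_const, rfl, rfl⟩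

theorem IsSmoothlyConnectedToOne.mul {n : ℕ} {U V : Matrix.unitaryGroup (Fin n) ℂ}
    (hU : IsSmoothlyConnectedToOne U) (hV : IsSmoothlyConnectedToOne V) :
    IsSmoothlyConnectedToOne (U * V) := by
  obtain ⟨g, hg, hg0, hg1⟩ := hU
  obtain ⟨k, hk, hk0, hk1⟩ := hV
  exact ⟨fun t => g t * k t, ContDiff.mat_mul hg hk, by simp [hg0, hk0], by simp [hg1, hk1]⟩

/-- A Hermitian involution `P` is the endpoint of the path `1 + (exp (i π t) - 1) (1 - P) / 2`. -/
theorem isSmoothlyConnectedToOne_of_involution {n : ℕ} (U : Matrix.unitaryGroup (Fin n) ℂ)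
    (hU : (U : Mat n)ᴴ = U) : IsSmoothlyConnectedToOne U := by
  have hUU : (U : Mat n) * U = 1 := by
    have h : (U : Mat n) * (U : Mat n)ᴴ = 1 := Matrix.mem_unitaryGroup_iff.1 U.2
    rwa [hU] at h
  -- `Q` is the orthogonal projection onto the `-1` eigenspace of `U`; hence `1 + (z - 1) • Q` is
  -- unitary whenever `|z| = 1`.
  set Q : Mat n := (1 / 2 : ℂ) • (1 - (U : Mat n)) with hQ
  have hQs : Qᴴ = Q := by
    rw [hQ, Matrix.conjTranspose_smul, Matrix.conjTranspose_sub, hU]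
    simp
  have hQQ : Q * Q = Q := by
    rw [hQ, smul_mul_smul_comm, sub_mul, mul_sub, mul_sub, hUU, mul_one, one_mul, mul_one]
    module
  have key : ∀ z : ℂ, z * star z = 1 →
      (1 + (z - 1) • Q) * (1 + (z - 1) • Q)ᴴ = 1 := by
    intro z hz
    rw [Matrix.conjTranspose_add, Matrix.conjTranspose_smul, hQs, Matrix.conjTranspose_one,
      mul_add, add_mul, add_mul, smul_mul_smul_comm, hQQ, mul_one, one_mul, mul_one, star_sub,
      star_one]
    have h : (z - 1) * (star z - 1) = 2 - z - star z := by linear_combination hz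
    rw [h]
    module
  have hz : ∀ t : ℝ, Complex.exp (((Real.pi * t : ℝ) : ℂ) * Complex.I) *
      star (Complex.exp (((Real.pi * t : ℝ) : ℂ) * Complex.I)) = 1 := by
    intro t
    rw [Complex.star_def, Complex.mul_conj, Complex.normSq_eq_norm_sq,
      Complex.norm_exp_ofReal_mul_I]
    simp
  refine ⟨fun t => ⟨1 + (Complex.exp (((Real.pi * t : ℝ) : ℂ) * Complex.I) - 1) • Q,
    Matrix.mem_unitaryGroup_iff.2 (key _ (hz t))⟩, ?_, ?_, ?_⟩
  · have h1 : ContDiff ℝ ∞ fun t : ℝ => Complex.exp (((Real.pi * t : ℝ) : ℂ) * Complex.I) - 1 := by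
      have h2 : ContDiff ℝ ∞ fun t : ℝ => ((Real.pi * t : ℝ) : ℂ) :=
        Complex.ofRealCLM.contDiff.comp (contDiff_const.mul contDiff_id)
      exact ((h2.mul contDiff_const).cexp).sub contDiff_const
    exact contDiff_const.add (h1.smul contDiff_const)
  · apply Subtype.ext
    simp
  · apply Subtype.ext
    simp only [mul_one, Complex.exp_pi_mul_I, hQ]
    module

/-- Scalars are central, so a skew-Hermitian generator may be made traceless, hence an element of
`su n`, without changing its vector field. -/
theorem infinitesimalAction_sub_smul_one {n : ℕ} (A X : Mat n) (c : ℂ) :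
    infinitesimalAction A (X - c • 1) = X * A - A * X := by
  simp [infinitesimalAction, sub_mul, mul_sub]

theorem sub_trace_smul_one_mem_su {n : ℕ} {X : Mat n} (hX : Xᴴ = -X) :
    X - (X.trace / n) • (1 : Mat n) ∈ su n := by
  have ht : star X.trace = -X.trace := by
    rw [← Matrix.trace_conjTranspose, hX, Matrix.trace_neg]
  constructor
  · rw [Matrix.conjTranspose_sub, Matrix.conjTranspose_smul, hX, Matrix.conjTranspose_one,
      star_div₀, ht, star_natCast, neg_div]
    module
  · rcases n with _ | n
    · simp [Matrix.trace]
    · have : ((n + 1 : ℕ) : ℂ) ≠ 0 := Nat.cast_ne_zero.2 n.succ_ne_zero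
      rw [Matrix.trace_sub, Matrix.trace_smul, Matrix.trace_one, Fintype.card_fin, smul_eq_mul,
        div_mul_cancel₀ _ this, sub_self]

/-- Conjugation by a unitary matrix that is smoothly connected to the identity is the time-one map
of the flow of `H (t, B) = Im tr (X t * B)`, where `X t = g' t * (g t)ᴴ`. -/
theorem IsSmoothlyConnectedToOne.isHamiltonianDiffeo {n : ℕ} (lam : torusDual n)
    {U : Matrix.unitaryGroup (Fin n) ℂ} (hU : IsSmoothlyConnectedToOne U) :
    IsHamiltonianDiffeo lam (unitaryConj lam U) := by
  obtain ⟨g, hg, hg0, hg1⟩ := hU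
  have hfst : ContDiff ℝ ∞ fun p : ℝ × Mat n => (g p.1 : Mat n) := hg.comp contDiff_fst
  set G : ℝ → Mat n := deriv fun t => (g t : Mat n)
  have hGd : ContDiff ℝ ∞ G := by
    have h : ContDiff ℝ (∞ + 1) fun t => (g t : Mat n) := hg
    exact (contDiff_succ_iff_deriv.1 h).2.2
  have hder : ∀ t, HasDerivAt (fun t => (g t : Mat n)) (G t) t := fun t =>
    (hg.differentiable (by simp) t).hasDerivAt
  have hgl : ∀ t, (g t : Mat n) * (g t : Mat n)ᴴ = 1 := fun t =>
    Matrix.mem_unitaryGroup_iff.1 (g t).2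
  have hgr : ∀ t, (g t : Mat n)ᴴ * (g t : Mat n) = 1 := fun t =>
    Matrix.mem_unitaryGroup_iff'.1 (g t).2
  set X : ℝ → Mat n := fun t => G t * (g t : Mat n)ᴴ with hX
  have hGX : ∀ t, G t = X t * g t := by
    intro t
    rw [hX, mul_assoc, hgr, mul_one]
  have hskew : ∀ t, (X t)ᴴ = -X t := by
    intro t
    -- Differentiate `g * gᴴ = 1`.
    have h1 := HasDerivAt.mat_mul (hder t) (HasDerivAt.mat_conjTranspose (hder t))
    have h2 : HasDerivAt (fun s => (g s : Mat n) * (g s : Mat n)ᴴ) 0 t := by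
      simp_rw [hgl]
      exact hasDerivAt_const _ _
    have h3 := h1.unique h2
    rw [hX, Matrix.conjTranspose_mul, Matrix.conjTranspose_conjTranspose]
    exact eq_neg_of_add_eq_zero_left h3
  refine ⟨fun t => unitaryConj lam (g t), ⟨?_, ?_, ?_, ?_⟩, ?_⟩
  · exact ⟨fun p => (g p.1 : Mat n) * p.2 * (g p.1 : Mat n)ᴴ,
      ContDiff.mat_mul (ContDiff.mat_mul hfst contDiff_snd) (ContDiff.mat_conjTranspose hfst),
      fun _ _ _ => rfl⟩
  · exact ⟨fun p => (g p.1 : Mat n)ᴴ * p.2 * ((g p.1 : Mat n)ᴴ)ᴴ,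
      ContDiff.mat_mul (ContDiff.mat_mul (ContDiff.mat_conjTranspose hfst) contDiff_snd)
        (ContDiff.mat_conjTranspose (ContDiff.mat_conjTranspose hfst)),
      fun _ _ _ => rfl⟩
  · rw [hg0, unitaryConj_one]
  · have hXd : ContDiff ℝ ∞ X := ContDiff.mat_mul hGd (ContDiff.mat_conjTranspose hg)
    refine ⟨fun p => imTraceCLM n (X p.1 * p.2),
      (imTraceCLM n).contDiff.comp (ContDiff.mat_mul (hXd.comp contDiff_fst) contDiff_snd), ?_⟩
    intro t _ A
    set B : Mat n := (unitaryConj lam (g t) A : Mat n)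
    have hB' : B = (g t : Mat n) * A * (g t : Mat n)ᴴ := rfl
    have hact := infinitesimalAction_sub_smul_one B (X t) ((X t).trace / n)
    refine ⟨⟨X t * B - B * X t, _, sub_trace_smul_one_mem_su (hskew t), hact⟩, ?_, ?_⟩
    · have h1 := HasDerivAt.mat_mul (HasDerivAt.mat_mul (hder t) (hasDerivAt_const t (A : Mat n)))
        (HasDerivAt.mat_conjTranspose (hder t))
      refine (h1.congr_deriv ?_).hasDerivWithinAt
      change _ = X t * B - B * X t
      rw [hGX, Matrix.conjTranspose_mul, hskew, hB']
      simp only [mul_zero, zero_add, mul_neg, Matrix.mul_assoc]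
      abel
    · rintro ⟨w, Y, hY, hYw⟩
      have hfd : fderiv ℝ (fun C : Mat n => imTraceCLM n (X t * C)) B w = (X t * w).trace.im := by
        have h := ((imTraceCLM n).comp (mulCLM n (X t))).hasFDerivAt (x := B)
        exact congrArg (fun L : Mat n →L[ℝ] ℝ => L w) h.fderiv
      refine Eq.trans ?_ hfd.symm
      rw [kksForm_apply (X := X t - ((X t).trace / n) • 1) (Y := Y) _ _ hact hYw,
        trace_mul_comm_eq_right, hYw]
      -- A commutator is traceless, so the scalar correction to `X t` drops out of `tr (w * X)`.
      have hw : w.trace = 0 := by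
        rw [← hYw, infinitesimalAction, LinearMap.coe_mk, AddHom.coe_mk, Matrix.trace_sub,
          Matrix.trace_mul_comm, sub_self]
      rw [mul_sub, Matrix.trace_sub, mul_smul_comm, mul_one, Matrix.trace_smul, hw, smul_zero,
        sub_zero, Matrix.trace_mul_comm]
  · change unitaryConj lam (g 1) = _
    rw [hg1]

end Smooth

/-! ### Permutation matrices and displacement of fibers -/

section Permutation

/-- The permutation matrix of `σ` as a unitary matrix. -/
noncomputable def permUnitary {n : ℕ} (σ : Equiv.Perm (Fin n)) : Matrix.unitaryGroup (Fin n) ℂ :=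
  ⟨σ.permMatrix ℂ, by
    rw [Matrix.mem_unitaryGroup_iff, Matrix.star_eq_conjTranspose,
      Matrix.conjTranspose_permMatrix, ← Matrix.permMatrix_mul]
    simp⟩

theorem isSmoothlyConnectedToOne_permUnitary {n : ℕ} (σ : Equiv.Perm (Fin n)) :
    IsSmoothlyConnectedToOne (permUnitary σ) := by
  induction σ using Equiv.Perm.swap_induction_on with
  | one =>
    convert IsSmoothlyConnectedToOne.one
    exact Subtype.ext Matrix.permMatrix_one
  | swap_mul σ i j hij ih =>
    -- `permMatrix` reverses products.
    have h : permUnitary (Equiv.swap i j * σ) = permUnitary σ * permUnitary (Equiv.swap i j) :=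
      Subtype.ext (Matrix.permMatrix_mul _ _)
    rw [h]
    refine ih.mul (isSmoothlyConnectedToOne_of_involution _ ?_)
    change ((Equiv.swap i j).permMatrix ℂ)ᴴ = (Equiv.swap i j).permMatrix ℂ
    rw [Matrix.conjTranspose_permMatrix, Equiv.swap_inv]

theorem isHamiltonianDiffeo_permUnitary {n : ℕ} (lam : torusDual n) (σ : Equiv.Perm (Fin n)) :
    IsHamiltonianDiffeo lam (unitaryConj lam (permUnitary σ)) :=
  (isSmoothlyConnectedToOne_permUnitary σ).isHamiltonianDiffeo lam

theorem coadjoint_evenPermMatrix {n : ℕ} (lam : torusDual n) (σ : alternatingGroup (Fin n)) :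
    coadjoint lam (evenPermMatrix σ) = unitaryConj lam (permUnitary σ) := rfl

/-- Row `i` of `permMatrix` has its `1` in column `σ i`, whence `σ` and not its inverse. -/
theorem momentumMap_permUnitary {n : ℕ} (lam : torusDual n) (σ : Equiv.Perm (Fin n))
    (A : orbit lam) (i : Fin n) :
    (momentumMap lam (unitaryConj lam (permUnitary σ) A) : Fin n → ℝ) i =
      (momentumMap lam A : Fin n → ℝ) (σ i) := by
  change ((σ.permMatrix ℂ * (A : Mat n) * (σ.permMatrix ℂ)ᴴ) i i).re = ((A : Mat n) (σ i) (σ i)).re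
  rw [Matrix.conjTranspose_permMatrix, PEquiv.toMatrix_toPEquiv_mul, PEquiv.mul_toMatrix_toPEquiv]
  rfl

theorem displaces_permUnitary {n : ℕ} (lam x : torusDual n) (σ : Equiv.Perm (Fin n)) {i : Fin n}
    (h : (x : Fin n → ℝ) (σ i) ≠ (x : Fin n → ℝ) i) :
    Displaces (unitaryConj lam (permUnitary σ)) (fiber lam x) := by
  rw [Displaces, Set.eq_empty_iff_forall_notMem]
  rintro _ ⟨⟨A, hA, rfl⟩, hB⟩
  have h1 := momentumMap_permUnitary lam σ A i
  rw [show momentumMap lam A = x from hA, show momentumMap lam _ = x from hB] at h1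
  exact h h1.symm

/-- If all coordinates were equal, their sum `n * x i` could vanish only for `x = 0`. -/
theorem exists_apply_ne_of_ne_zero {n : ℕ} {x : torusDual n} (hx : x ≠ 0) :
    ∃ i j, (x : Fin n → ℝ) i ≠ (x : Fin n → ℝ) j := by
  by_contra! h
  apply hx
  ext i
  have h0 : ∑ j, (x : Fin n → ℝ) j = 0 := x.2
  rw [Finset.sum_congr rfl fun j _ => h j i, Finset.sum_const, Finset.card_univ,
    Fintype.card_fin, nsmul_eq_mul] at h0
  have hn : (n : ℝ) ≠ 0 := Nat.cast_ne_zero.2 (Fin.pos i).ne'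
  simpa using (mul_eq_zero.1 h0).resolve_left hn

theorem exists_mem_alternatingGroup_apply_eq {α : Type*} [Fintype α] [DecidableEq α]
    (h : 3 ≤ Fintype.card α) (i j : α) :
    ∃ σ : alternatingGroup α, (σ : Equiv.Perm α) i = j := by
  obtain ⟨k, hk⟩ : ∃ k, k ∉ ({i, j} : Finset α) := by
    by_contra! hall
    have h1 := Finset.card_le_card (fun a _ => hall a : Finset.univ ⊆ ({i, j} : Finset α))
    have h2 := Finset.card_le_two (a := i) (b := j)
    rw [Finset.card_univ] at h1
    omega
  simp only [Finset.mem_insert, Finset.mem_singleton, not_or] at hk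
  -- Two transpositions through a third point, `i ↦ k ↦ j`: a 3-cycle, or the identity if `i = j`.
  refine ⟨⟨Equiv.swap j k * Equiv.swap i k, ?_⟩, ?_⟩
  · rw [Equiv.Perm.mem_alternatingGroup, Equiv.Perm.sign_mul, Equiv.Perm.sign_swap (Ne.symm hk.2),
      Equiv.Perm.sign_swap (Ne.symm hk.1)]
    simp
  · simp

end Permutation

end SUOrbit

theorem mainTheorem4 (n : ℕ) (lam : SUOrbit.torusDual n)
    (hlam : StrictAnti (lam : Fin n → ℝ))
    (x : SUOrbit.torusDual n)
    (hx : x ∈ interior (SUOrbit.momentPolytope lam))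
    (hx0 : x ≠ 0) :
    SUOrbit.IsDisplaceable lam (SUOrbit.fiber lam x) ∧
    (∀ σ : alternatingGroup (Fin n),
      SUOrbit.IsHamiltonianDiffeo lam
        (SUOrbit.coadjoint lam (SUOrbit.evenPermMatrix σ))) ∧
    (3 ≤ n → ∃ σ : alternatingGroup (Fin n),
      SUOrbit.Displaces (SUOrbit.coadjoint lam (SUOrbit.evenPermMatrix σ))
        (SUOrbit.fiber lam x)) := by
  obtain ⟨i, j, hij⟩ := SUOrbit.exists_apply_ne_of_ne_zero hx0
  refine ⟨⟨_, SUOrbit.isHamiltonianDiffeo_permUnitary lam (Equiv.swap i j),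
    SUOrbit.displaces_permUnitary lam x _ (i := j) (by simpa using hij)⟩, fun σ => ?_, fun hn => ?_⟩
  · rw [SUOrbit.coadjoint_evenPermMatrix]
    exact SUOrbit.isHamiltonianDiffeo_permUnitary lam σ
  · obtain ⟨σ, hσ⟩ := SUOrbit.exists_mem_alternatingGroup_apply_eq
      (by rwa [Fintype.card_fin]) j i
    refine ⟨σ, ?_⟩
    rw [SUOrbit.coadjoint_evenPermMatrix]
    exact SUOrbit.displaces_permUnitary lam x _ (i := j) (by rwa [hσ])
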